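/- Let $n\ge 2$ and let $\mathcal L\subset\mathbb R^n$ be a full-rank integral lattice, i.e. a full-rank lattice with $\langle x,y\rangle\in\mathbb Z$ for all $x,y\in\mathcal L$. For a positive integer $k$ put $N_{=k}(\mathcal L)=|\{y\in\mathcal L:\|y\|^2=k\}|$, and say that equality holds in the shell bound at $k$ if $$N_{=k}(\mathcal L)=2\binom{n+2k-2}{2k-1}.$$ Then: 1. If equality holds in the shell bound at $k=2$, that is, $N_{=2}(\mathcal L)=2\binom{n+2}{3}$, then $n=8$. 2. Equality in the shell bound at $k=3$ never holds, that is, $N_{=3}(\mathcal L)\ne 2\binom{n+4}{5}$. -/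

import Mathlib

/-!
Choose one vector from each antipodal pair of the shell, giving a set `Y`. Distinct `x, y ∈ Y` have
integral inner product of absolute value less than `k`, so the homogeneous polynomial
`F_y = ⟨·, y⟩ ∏_{0 < j < k} (⟨·, y⟩² - (j² / k) ‖·‖²)` of degree `2k - 1` vanishes on `Y` except at
`y`, where its value is `(2k - 1)!`. Equality in the shell bound says that `|Y|` is the dimension of
the space of homogeneous polynomials of degree `2k - 1`, so the `F_y` form a basis of it and
`(2k - 1)! p = ∑ p(y) F_y` for every such `p`. Since `Δ^(k-1) F_y` is a multiple of `⟨·, y⟩`,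
applying `Δ^(k-1)` to this formula for `p = ⟨·, a⟩ ‖·‖^(2k-2)` gives a tight frame identity
`c a = b ∑ ⟨y, a⟩ y`, where `b` and `c` are polynomials in `n`. Its trace is a polynomial equation
in `n`: up to nonzero factors it is `n - 8 = 0` for `k = 2`, and for `k = 3` a cubic equation
without roots modulo `13`.
-/

namespace LatticeShell

/-- A `ℤ`-submodule of `ℝⁿ` is integral if all its inner products are integers. -/
def IsIntegral {n : ℕ} (L : Submodule ℤ (EuclideanSpace ℝ (Fin n))) : Prop :=
  ∀ x ∈ L, ∀ y ∈ L, ∃ m : ℤ, inner ℝ x y = (m : ℝ)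

/-- The norm-`k` shell `{y ∈ L : ‖y‖² = k}`. -/
def shell {n : ℕ} (L : Submodule ℤ (EuclideanSpace ℝ (Fin n))) (k : ℕ) :
    Set (EuclideanSpace ℝ (Fin n)) :=
  {y | y ∈ L ∧ ‖y‖ ^ 2 = (k : ℝ)}

/-- Equality in the shell bound `|shell L k| ≤ 2 * binom (n + 2k - 2) (2k - 1)`, for `k ≥ 1`.
The right-hand side is positive for `n ≥ 1`, so the equality also says that the shell is finite
and non-empty. -/
def ShellEquality {n : ℕ} (L : Submodule ℤ (EuclideanSpace ℝ (Fin n))) (k : ℕ) : Prop :=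
  (shell L k).ncard = 2 * Nat.choose (n + 2 * k - 2) (2 * k - 1)

end LatticeShell

open Finset Module MvPolynomial
open scoped Nat

namespace LatticeShell

lemma smul_eq_sum_dual_smul {K M ι : Type*} [Field K] [AddCommGroup M] [Module K M] [Fintype ι]
    {V : Submodule K M} [FiniteDimensional K V] (hV : finrank K V ≤ Fintype.card ι)
    {f : ι → Dual K M} {v : ι → M} {c : K} (hc : c ≠ 0) (hv : ∀ i, v i ∈ V)
    (hdiag : ∀ i, f i (v i) = c) (hoff : Pairwise fun i j ↦ f i (v j) = 0)
    {p : M} (hp : p ∈ V) : c • p = ∑ i, f i p • v i := by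
  have hli : LinearIndependent K v := .of_pairwise_dual_eq_zero_one v (fun i ↦ c⁻¹ • f i)
    (fun i j hij ↦ by simp [hoff hij]) (fun i ↦ by simp [hdiag, hc])
  have hspan : Submodule.span K (Set.range v) = V :=
    Submodule.eq_of_le_of_finrank_le (Submodule.span_le.2 <| Set.range_subset_iff.2 hv)
      (hV.trans (finrank_span_eq_card hli).ge)
  obtain ⟨g, rfl⟩ := (Submodule.mem_span_range_iff_exists_fun K).1 (hspan ▸ hp)
  have hcoeff (i : ι) : f i (∑ j, g j • v j) = g i * c := by
    rw [map_sum, Fintype.sum_eq_single i fun j hj ↦ by rw [map_smul, hoff hj.symm, smul_zero],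
      map_smul, hdiag, smul_eq_mul]
  simp only [hcoeff, smul_sum, smul_smul, mul_comm c]

lemma exists_half_of_neg_mem {E : Type*} [InvolutiveNeg E] {X : Finset E}
    (hneg : ∀ x ∈ X, -x ∈ X) (hne : ∀ x ∈ X, -x ≠ x) :
    ∃ Y ⊆ X, #X = 2 * #Y ∧ ∀ y ∈ Y, -y ∉ Y := by
  classical
  obtain ⟨_, -⟩ := exists_wellFoundedLT E
  refine ⟨{x ∈ X | x < -x}, filter_subset _ _, ?_, fun y hy hy' ↦ ?_⟩
  · have hcard : #{x ∈ X | ¬ x < -x} = #{x ∈ X | x < -x} := by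
      refine card_nbij' (- ·) (- ·) (fun x hx ↦ ?_) (fun x hx ↦ ?_) (by simp [Set.LeftInvOn])
        (by simp [Set.LeftInvOn])
      · simp only [coe_filter, Set.mem_ofPred_eq, not_lt] at hx ⊢
        simpa [hneg x hx.1] using hx.2.lt_of_ne (hne x hx.1)
      · simp only [coe_filter, Set.mem_ofPred_eq, not_lt] at hx ⊢
        simpa [hneg x hx.1] using hx.2.le
    rw [← card_filter_add_card_filter_not (s := X) (fun x ↦ x < -x), hcard, two_mul]
  · simp only [mem_filter, neg_neg] at hy hy'
    exact lt_asymm hy.2 hy'.2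

lemma mul_prod_Ico_sq_sub_sq {k : ℕ} (hk : 1 ≤ k) :
    (k : ℝ) * ∏ j ∈ Ico 1 k, ((k : ℝ) ^ 2 - j ^ 2) = (2 * k - 1)! := by
  obtain ⟨m, rfl⟩ := Nat.exists_eq_add_of_le' hk
  have hfac : ∏ j ∈ range m, ((m : ℝ) - j) = m ! := by
    rw [← Nat.descFactorial_self, Nat.descFactorial_eq_prod_range, Nat.cast_prod]
    exact prod_congr rfl fun j hj ↦ (Nat.cast_sub (mem_range.1 hj).le).symm
  have hasc : ∏ j ∈ range m, ((m : ℝ) + 2 + j) = (m + 2).ascFactorial m := by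
    simp [Nat.ascFactorial_eq_prod_range]
  rw [prod_Ico_eq_prod_range, show 2 * (m + 1) - 1 = m + 1 + m by omega,
    ← Nat.factorial_mul_ascFactorial, Nat.factorial_succ]
  push_cast
  rw [← hfac, ← hasc, mul_assoc, ← prod_mul_distrib]
  congr 1
  exact prod_congr rfl fun j _ ↦ by ring

section Polynomials

variable {σ R : Type*} [Fintype σ] [CommSemiring R]

lemma finrank_homogeneousSubmodule [StrongRankCondition R] (d : ℕ) :
    finrank R (homogeneousSubmodule σ R d) = (Fintype.card σ + d - 1).choose d := by
  classical
  have hdeg : {e : σ →₀ ℕ | e.degree = d} = ((univ : Finset σ).finsuppAntidiag d : Set _) := by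
    ext e
    simp [Finsupp.degree_eq_sum]
  rw [homogeneousSubmodule_eq_finsupp_supported,
    (AddMonoidAlgebra.supportedEquivFinsupp _).finrank_eq, hdeg, finrank_finsupp_self]
  simp [card_finsuppAntidiag_nat_eq_choose]

/-- The linear form `⟨·, y⟩`, as a polynomial. -/
noncomputable def linearForm (y : σ → R) : MvPolynomial σ R := ∑ i, C (y i) * X i

/-- The Laplacian `Δ = ∑ ∂²/∂xᵢ²`, acting algebraically on polynomials. -/
noncomputable def laplacian : MvPolynomial σ R →ₗ[R] MvPolynomial σ R :=
  ∑ i, (pderiv i).toLinearMap ∘ₗ (pderiv i).toLinearMap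

lemma laplacian_apply (f : MvPolynomial σ R) : laplacian f = ∑ i, pderiv i (pderiv i f) := by
  simp [laplacian, LinearMap.sum_apply]

lemma eval_linearForm (x y : σ → R) : eval x (linearForm y) = x ⬝ᵥ y := by
  simp [linearForm, dotProduct, mul_comm]

lemma eval_psum_two (x : σ → R) : eval x (psum σ R 2) = x ⬝ᵥ x := by
  simp [psum, dotProduct, pow_two]

lemma isHomogeneous_linearForm (y : σ → R) : (linearForm y).IsHomogeneous 1 :=
  .sum _ _ _ fun i _ ↦ isHomogeneous_C_mul_X (y i) i

lemma isHomogeneous_psum (d : ℕ) : (psum σ R d).IsHomogeneous d :=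
  .sum _ _ _ fun i _ ↦ isHomogeneous_X_pow i d

lemma pderiv_linearForm (y : σ → R) (i : σ) : pderiv i (linearForm y) = C (y i) := by
  classical
  simp [linearForm, pderiv_X, Pi.single_apply]

lemma pderiv_psum_two (i : σ) : pderiv i (psum σ R 2) = 2 * X i := by
  classical
  simp [psum, pderiv_X, Pi.single_apply]

lemma laplacian_linearForm_pow (y : σ → R) (a : ℕ) :
    laplacian (linearForm y ^ (a + 2)) =
      ((a + 2) * (a + 1) * (y ⬝ᵥ y)) • linearForm y ^ a := by
  simp only [laplacian_apply, dotProduct, smul_eq_C_mul, mul_sum, map_sum, sum_mul]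
  refine sum_congr rfl fun i _ ↦ ?_
  simp only [pderiv_pow, pderiv_mul, pderiv_linearForm, pderiv_C, Derivation.map_natCast,
    Nat.add_sub_cancel, Nat.add_succ_sub_one, map_mul, map_add, map_natCast, map_one, map_ofNat]
  push_cast
  ring

lemma laplacian_mul (f g : MvPolynomial σ R) :
    laplacian (f * g) =
      laplacian f * g + 2 * ∑ i, pderiv i f * pderiv i g + f * laplacian g := by
  simp only [laplacian_apply, sum_mul, mul_sum, ← sum_add_distrib, pderiv_mul, map_add]
  exact sum_congr rfl fun i _ ↦ by ring

lemma sum_pderiv_mul_pderiv_psum_two_pow {f : MvPolynomial σ R} {d : ℕ} (hf : f.IsHomogeneous d)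
    (b : ℕ) :
    ∑ i, pderiv i f * pderiv i (psum σ R 2 ^ (b + 1)) =
      (2 * d * (b + 1)) • (f * psum σ R 2 ^ b) := by
  calc _ = 2 * (b + 1) * psum σ R 2 ^ b * ∑ i, X i * pderiv i f := by
        simp only [pderiv_pow, pderiv_psum_two, mul_sum]
        refine sum_congr rfl fun i _ ↦ ?_
        push_cast [Nat.add_sub_cancel]
        ring
    _ = _ := by
        rw [hf.sum_X_mul_pderiv]
        simp only [nsmul_eq_mul]
        push_cast
        ring

lemma laplacian_psum_two : laplacian (psum σ R 2) = 2 * Fintype.card σ := by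
  have h : ∀ i : σ, pderiv i (2 : MvPolynomial σ R) = 0 := fun i ↦ (pderiv i).map_natCast 2
  simp [laplacian_apply, pderiv_psum_two, h, mul_comm]

lemma laplacian_psum_two_pow (b : ℕ) :
    laplacian (psum σ R 2 ^ (b + 1)) =
      (2 * (b + 1) * (Fintype.card σ + 2 * b)) • psum σ R 2 ^ b := by
  induction b with
  | zero => simp [laplacian_psum_two]
  | succ b ih =>
    rw [pow_succ', laplacian_mul, ih, sum_pderiv_mul_pderiv_psum_two_pow (isHomogeneous_psum 2),
      laplacian_psum_two]
    simp only [nsmul_eq_mul]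
    push_cast
    ring

lemma laplacian_mul_psum_two_pow {f : MvPolynomial σ R} {d : ℕ} (hf : f.IsHomogeneous d)
    (b : ℕ) :
    laplacian (f * psum σ R 2 ^ (b + 1)) = laplacian f * psum σ R 2 ^ (b + 1) +
      (2 * (b + 1) * (Fintype.card σ + 2 * d + 2 * b)) • (f * psum σ R 2 ^ b) := by
  rw [laplacian_mul, sum_pderiv_mul_pderiv_psum_two_pow hf, laplacian_psum_two_pow]
  simp only [nsmul_eq_mul]
  push_cast
  ring

lemma laplacian_linearForm (y : σ → R) : laplacian (linearForm y) = 0 := by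
  simp [laplacian_apply, pderiv_linearForm]

/-- The scalar `c` with `Δ^m (ℓ ‖·‖^(2m)) = c ℓ` for every linear form `ℓ` in `n` variables. -/
def radialCoeff (n m : ℕ) : ℕ := ∏ j ∈ range m, 2 * (j + 1) * (n + 2 * j + 2)

lemma laplacian_pow_linearForm_mul_psum_two_pow (y : σ → R) (m : ℕ) :
    (laplacian ^ m) (linearForm y * psum σ R 2 ^ m) =
      radialCoeff (Fintype.card σ) m • linearForm y := by
  induction m with
  | zero => simp [radialCoeff]
  | succ m ih =>
    rw [pow_succ, Module.End.mul_apply, laplacian_mul_psum_two_pow (isHomogeneous_linearForm y),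
      laplacian_linearForm, zero_mul, zero_add, map_nsmul, ih, smul_smul, radialCoeff, radialCoeff,
      prod_range_succ]
    congr 1
    ring

end Polynomials

section ShellPolynomial

variable {ι : Type*} [Fintype ι]

lemma ofLp_dotProduct_ofLp (x y : EuclideanSpace ℝ ι) : x.ofLp ⬝ᵥ y.ofLp = inner ℝ x y := by
  simp [EuclideanSpace.inner_eq_star_dotProduct, dotProduct_comm]

lemma ofLp_dotProduct_self (x : EuclideanSpace ℝ ι) : x.ofLp ⬝ᵥ x.ofLp = ‖x‖ ^ 2 := by
  rw [ofLp_dotProduct_ofLp, real_inner_self_eq_norm_sq]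

/-- The polynomial `⟨·, y⟩ ∏_{0 < j < k} (⟨·, y⟩² - (j² / k) ‖·‖²)`. The square of the norm is the
power sum `psum ι ℝ 2`; its coefficient makes the product homogeneous while on the sphere
`‖·‖² = k` the factors become `⟨·, y⟩² - j²`. -/
noncomputable def shellPolynomial (k : ℕ) (y : EuclideanSpace ℝ ι) : MvPolynomial ι ℝ :=
  linearForm y.ofLp *
    ∏ j ∈ Ico 1 k, (linearForm y.ofLp ^ 2 - ((j : ℝ) ^ 2 / k) • psum ι ℝ 2)

lemma isHomogeneous_shellPolynomial {k : ℕ} (hk : 1 ≤ k) (y : EuclideanSpace ℝ ι) :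
    (shellPolynomial k y).IsHomogeneous (2 * k - 1) := by
  have hfactor (j : ℕ) :
      (linearForm y.ofLp ^ 2 - ((j : ℝ) ^ 2 / k) • psum ι ℝ 2).IsHomogeneous 2 := by
    rw [smul_eq_C_mul]
    exact ((isHomogeneous_linearForm _).pow 2).sub ((isHomogeneous_psum 2).C_mul _)
  have h := (isHomogeneous_linearForm y.ofLp).mul (.prod (Ico 1 k) _ _ fun j _ ↦ hfactor j)
  rwa [sum_const, Nat.card_Ico, smul_eq_mul, show 1 + (k - 1) * 2 = 2 * k - 1 by omega] at h

lemma eval_shellPolynomial {k : ℕ} (hk : k ≠ 0) {x : EuclideanSpace ℝ ι} (hx : ‖x‖ ^ 2 = k)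
    (y : EuclideanSpace ℝ ι) :
    eval x.ofLp (shellPolynomial k y) =
      inner ℝ x y * ∏ j ∈ Ico 1 k, (inner ℝ x y ^ 2 - (j : ℝ) ^ 2) := by
  simp [shellPolynomial, eval_linearForm, eval_psum_two, ofLp_dotProduct_ofLp, smul_eval, hx, hk]

lemma eval_self_shellPolynomial {k : ℕ} (hk : 1 ≤ k) {y : EuclideanSpace ℝ ι}
    (hy : ‖y‖ ^ 2 = k) : eval y.ofLp (shellPolynomial k y) = (2 * k - 1)! := by
  rw [eval_shellPolynomial (by omega) hy, real_inner_self_eq_norm_sq, hy,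
    mul_prod_Ico_sq_sub_sq hk]

lemma eval_shellPolynomial_eq_zero {k : ℕ} {x y : EuclideanSpace ℝ ι}
    (hx : ‖x‖ ^ 2 = k) {m : ℤ} (hm : inner ℝ x y = m) (hmk : m.natAbs < k) :
    eval x.ofLp (shellPolynomial k y) = 0 := by
  rw [eval_shellPolynomial (by omega) hx, hm]
  obtain rfl | hm0 := eq_or_ne m 0
  · simp
  · refine mul_eq_zero_of_right _ (prod_eq_zero (i := m.natAbs) ?_ ?_)
    · exact mem_Ico.2 ⟨Int.natAbs_pos.2 hm0, hmk⟩
    · simp [Nat.cast_natAbs]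

/-- A set of representatives of the antipodal pairs in a norm-`k` shell attaining the shell bound,
described without reference to the lattice. -/
structure IsExtremalHalfShell (k : ℕ) (Y : Finset (EuclideanSpace ℝ ι)) : Prop where
  card_eq : #Y = (Fintype.card ι + 2 * k - 2).choose (2 * k - 1)
  norm_sq : ∀ y ∈ Y, ‖y‖ ^ 2 = k
  exists_inner_eq : ∀ x ∈ Y, ∀ y ∈ Y, x ≠ y → ∃ m : ℤ, inner ℝ x y = m ∧ m.natAbs < k

namespace IsExtremalHalfShell

variable {k : ℕ} {Y : Finset (EuclideanSpace ℝ ι)}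

lemma factorial_mul_card (hY : IsExtremalHalfShell k Y) (hk : 1 ≤ k) :
    (2 * k - 1)! * #Y = (Fintype.card ι).ascFactorial (2 * k - 1) := by
  rw [hY.card_eq, Nat.ascFactorial_eq_factorial_mul_choose',
    show Fintype.card ι + (2 * k - 1) - 1 = Fintype.card ι + 2 * k - 2 by omega]

theorem factorial_smul_eq_sum (hY : IsExtremalHalfShell k Y) (hk : 1 ≤ k)
    {p : MvPolynomial ι ℝ} (hp : p.IsHomogeneous (2 * k - 1)) :
    ((2 * k - 1)! : ℝ) • p = ∑ y ∈ Y, eval y.ofLp p • shellPolynomial k y := by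
  have : FiniteDimensional ℝ (homogeneousSubmodule ι ℝ (2 * k - 1)) :=
    .of_fg (homogeneousSubmodule_fg ι ℝ _)
  have hrank : finrank ℝ (homogeneousSubmodule ι ℝ (2 * k - 1)) ≤ Fintype.card Y := by
    rw [finrank_homogeneousSubmodule, Fintype.card_coe, hY.card_eq]
    exact (congrArg (Nat.choose · _) (by omega)).le
  have hoff : Pairwise fun x y : Y ↦ eval x.1.ofLp (shellPolynomial k y.1) = 0 := by
    intro x y hxy
    obtain ⟨m, hm, hmk⟩ := hY.exists_inner_eq x x.2 y y.2 (Subtype.coe_injective.ne hxy)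
    exact eval_shellPolynomial_eq_zero (hY.norm_sq x x.2) hm hmk
  rw [← sum_coe_sort Y]
  exact smul_eq_sum_dual_smul hrank (f := fun y : Y ↦ (aeval y.1.ofLp).toLinearMap)
    (v := fun y : Y ↦ shellPolynomial k y.1) (by positivity)
    (fun y ↦ isHomogeneous_shellPolynomial hk _)
    (fun y ↦ eval_self_shellPolynomial hk (hY.norm_sq y y.2)) hoff hp

theorem tight_frame_identity (hY : IsExtremalHalfShell k Y) (hk : 1 ≤ k) {β : ℝ}
    (hβ : ∀ y ∈ Y, (laplacian ^ (k - 1)) (shellPolynomial k y) = β • linearForm y.ofLp)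
    (a : ι → ℝ) :
    ((2 * k - 1)! : ℝ) • radialCoeff (Fintype.card ι) (k - 1) • linearForm a =
      ∑ y ∈ Y, (β * k ^ (k - 1) * (y.ofLp ⬝ᵥ a)) • linearForm y.ofLp := by
  have hp : (linearForm a * psum ι ℝ 2 ^ (k - 1)).IsHomogeneous (2 * k - 1) := by
    have h := (isHomogeneous_linearForm a).mul ((isHomogeneous_psum (σ := ι) 2).pow (k - 1))
    rwa [show 1 + 2 * (k - 1) = 2 * k - 1 by omega] at h
  rw [← laplacian_pow_linearForm_mul_psum_two_pow, ← map_smul, hY.factorial_smul_eq_sum hk hp,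
    map_sum]
  refine sum_congr rfl fun y hy ↦ ?_
  rw [map_smul, hβ y hy, smul_smul, map_mul, map_pow, eval_linearForm, eval_psum_two,
    ofLp_dotProduct_self, hY.norm_sq y hy]
  congr 1
  ring

theorem trace_identity (hY : IsExtremalHalfShell k Y) (hk : 1 ≤ k) {β : ℝ}
    (hβ : ∀ y ∈ Y, (laplacian ^ (k - 1)) (shellPolynomial k y) = β • linearForm y.ofLp) :
    ((2 * k - 1)! : ℝ) ^ 2 * radialCoeff (Fintype.card ι) (k - 1) * Fintype.card ι =
      β * k ^ k * (Fintype.card ι).ascFactorial (2 * k - 1) := by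
  classical
  set α := radialCoeff (Fintype.card ι) (k - 1)
  have hdiag (i : ι) : ((2 * k - 1)! : ℝ) * α = ∑ y ∈ Y, β * k ^ (k - 1) * (y i * y i) := by
    simpa [eval_linearForm, smul_eval, mul_assoc] using
      congrArg (eval (Pi.single i 1)) (hY.tight_frame_identity hk hβ (Pi.single i 1))
  have htrace : ((2 * k - 1)! : ℝ) * α * Fintype.card ι = β * k ^ k * #Y :=
    calc ((2 * k - 1)! : ℝ) * α * Fintype.card ι
        = ∑ i, ∑ y ∈ Y, β * k ^ (k - 1) * (y i * y i) := by
          simp [← hdiag, mul_comm]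
      _ = ∑ y ∈ Y, β * k ^ (k - 1) * ‖y‖ ^ 2 := by
          rw [sum_comm]
          simp [← mul_sum, EuclideanSpace.real_norm_sq_eq, ← pow_two]
      _ = ∑ _ ∈ Y, β * k ^ k := by
          refine sum_congr rfl fun y hy ↦ ?_
          rw [hY.norm_sq y hy, mul_assoc, pow_sub_one_mul (by omega)]
      _ = β * k ^ k * #Y := by simp [mul_comm]
  rw [pow_two, mul_assoc _ _ (α : ℝ), mul_assoc, htrace, ← hY.factorial_mul_card hk]
  push_cast
  ring

end IsExtremalHalfShell

lemma laplacian_shellPolynomial_two {y : EuclideanSpace ℝ ι} (hy : ‖y‖ ^ 2 = 2) :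
    laplacian (shellPolynomial 2 y) = (10 - Fintype.card ι : ℝ) • linearForm y.ofLp := by
  have hexpand : shellPolynomial 2 y =
      linearForm y.ofLp ^ 3 - (1 / 2 : ℝ) • (linearForm y.ofLp * psum ι ℝ 2 ^ 1) := by
    rw [shellPolynomial, Nat.Ico_succ_singleton, prod_singleton]
    algebra
  rw [hexpand, map_sub, map_smul, laplacian_linearForm_pow _ 1,
    laplacian_mul_psum_two_pow (isHomogeneous_linearForm _) 0, laplacian_linearForm,
    ofLp_dotProduct_self, hy]
  simp only [zero_mul, zero_add, mul_one, pow_zero, pow_one]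
  push_cast
  module

lemma laplacian_sq_shellPolynomial_three {y : EuclideanSpace ℝ ι} (hy : ‖y‖ ^ 2 = 3) :
    (laplacian ^ 2) (shellPolynomial 3 y) =
      (8 / 9 * (4 * Fintype.card ι ^ 2 - 111 * Fintype.card ι + 707) : ℝ) •
        linearForm y.ofLp := by
  have hexpand : shellPolynomial 3 y =
      linearForm y.ofLp ^ 5 - (5 / 3 : ℝ) • (linearForm y.ofLp ^ 3 * psum ι ℝ 2 ^ 1) +
        (4 / 9 : ℝ) • (linearForm y.ofLp * psum ι ℝ 2 ^ 2) := by
    rw [shellPolynomial, prod_Ico_succ_top (Nat.le_succ 1), Nat.Ico_succ_singleton, prod_singleton]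
    algebra
  rw [hexpand, pow_two, Module.End.mul_apply, map_add, map_sub, map_smul, map_smul,
    laplacian_linearForm_pow _ 3,
    laplacian_mul_psum_two_pow ((isHomogeneous_linearForm _).pow 3) 0,
    laplacian_linearForm_pow _ 1, ofLp_dotProduct_self, hy,
    laplacian_mul_psum_two_pow (isHomogeneous_linearForm _) 1, laplacian_linearForm]
  simp only [zero_mul, zero_add, pow_zero, mul_one, smul_mul_assoc, map_add, map_sub, map_smul,
    map_nsmul, laplacian_linearForm_pow _ 1, ofLp_dotProduct_self, hy, pow_one (linearForm _),
    laplacian_mul_psum_two_pow (isHomogeneous_linearForm _) 0, laplacian_linearForm]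
  push_cast
  module

lemma IsExtremalHalfShell.card_index_eq_eight {Y : Finset (EuclideanSpace ℝ ι)}
    (hY : IsExtremalHalfShell 2 Y) (hι : 2 ≤ Fintype.card ι) : Fintype.card ι = 8 := by
  set n := Fintype.card ι
  have hlaplacian : ∀ y ∈ Y,
      (laplacian ^ (2 - 1)) (shellPolynomial 2 y) = (10 - n : ℝ) • linearForm y.ofLp :=
    fun y hy ↦ laplacian_shellPolynomial_two (hY.norm_sq y hy)
  have htrace : (6 ^ 2 * (2 * (n + 2)) * n : ℝ) =
      (10 - n) * 2 ^ 2 * ((n + 2) * ((n + 1) * n)) := by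
    simpa [Nat.ascFactorial, Nat.factorial, radialCoeff] using
      hY.trace_identity one_le_two hlaplacian
  have hn : (2 : ℝ) ≤ n := by exact_mod_cast hι
  have hfactor : (4 * n * (n + 2) * (n - 1) : ℝ) * (n - 8) = 0 := by
    linear_combination htrace
  have hpos : (0 : ℝ) < 4 * n * (n + 2) * (n - 1) := mul_pos (by positivity) (by linarith)
  exact_mod_cast sub_eq_zero.1 ((mul_eq_zero.1 hfactor).resolve_left hpos.ne')

lemma not_isExtremalHalfShell_three (hι : 2 ≤ Fintype.card ι) (Y : Finset (EuclideanSpace ℝ ι)) :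
    ¬ IsExtremalHalfShell 3 Y := by
  intro hY
  set n := Fintype.card ι
  have htrace : (120 ^ 2 * (2 * (n + 2) * (4 * (n + 2 + 2))) * n : ℝ) =
      8 / 9 * (4 * n ^ 2 - 111 * n + 707) * 3 ^ 3 *
        ((n + 4) * ((n + 3) * ((n + 2) * ((n + 1) * n)))) := by
    simpa [Nat.ascFactorial, Nat.factorial, radialCoeff, prod_range_succ] using
      hY.trace_identity (by norm_num) fun y hy ↦
        laplacian_sq_shellPolynomial_three (hY.norm_sq y hy)
  have hn : (2 : ℝ) ≤ n := by exact_mod_cast hι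
  have hfactor : (24 * n * (n + 2) * (n + 4) * (n - 1) : ℝ) *
      (4 * n ^ 3 - 91 * n ^ 2 + 184 * n + 2679) = 0 := by
    linear_combination -htrace
  have hpos : (0 : ℝ) < 24 * n * (n + 2) * (n + 4) * (n - 1) :=
    mul_pos (by positivity) (by linarith)
  have hroot : (4 * n ^ 3 - 91 * n ^ 2 + 184 * n + 2679 : ℤ) = 0 := by
    exact_mod_cast (mul_eq_zero.1 hfactor).resolve_left hpos.ne'
  have hmod : ∀ z : ZMod 13, 4 * z ^ 3 - 91 * z ^ 2 + 184 * z + 2679 ≠ 0 := by decide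
  exact hmod n (by exact_mod_cast congrArg (Int.cast : ℤ → ZMod 13) hroot)

end ShellPolynomial

lemma ShellEquality.exists_isExtremalHalfShell {n k : ℕ} (hn : 1 ≤ n) (hk : 1 ≤ k)
    {L : Submodule ℤ (EuclideanSpace ℝ (Fin n))} (hL : IsIntegral L) (h : ShellEquality L k) :
    ∃ Y : Finset (EuclideanSpace ℝ (Fin n)), IsExtremalHalfShell k Y := by
  have hpos : 0 < (n + 2 * k - 2).choose (2 * k - 1) := Nat.choose_pos (by omega)
  have hfin : (shell L k).Finite := Set.finite_of_ncard_ne_zero (h.trans_ne (by positivity))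
  have hmem {x} : x ∈ hfin.toFinset ↔ x ∈ L ∧ ‖x‖ ^ 2 = k := hfin.mem_toFinset
  have hne : ∀ x ∈ hfin.toFinset, -x ≠ x := by
    have : IsAddTorsionFree (EuclideanSpace ℝ (Fin n)) := .of_module_rat _
    intro x hx hxneg
    have hk0 : (k : ℝ) = 0 := by
      rw [← (hmem.1 hx).2, self_eq_neg.1 hxneg.symm, norm_zero, zero_pow two_ne_zero]
    exact Nat.one_le_iff_ne_zero.1 hk (Nat.cast_eq_zero.1 hk0)
  obtain ⟨Y, hYX, hcard, hY⟩ :=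
    exists_half_of_neg_mem (X := hfin.toFinset) (fun x hx ↦ by simpa [hmem] using hx) hne
  rw [← Set.ncard_eq_toFinset_card _ hfin, h] at hcard
  refine ⟨Y, ?_, fun y hy ↦ (hmem.1 (hYX hy)).2, fun x hx y hy hxy ↦ ?_⟩
  · rw [Fintype.card_fin]
    omega
  obtain ⟨hxL, hxk⟩ := hmem.1 (hYX hx)
  obtain ⟨hyL, hyk⟩ := hmem.1 (hYX hy)
  obtain ⟨m, hm⟩ := hL x hxL y hyL
  have hsub : 0 < ‖x - y‖ ^ 2 := pow_pos (norm_pos_iff.2 (sub_ne_zero.2 hxy)) 2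
  have hxny : x + y ≠ 0 := fun h0 ↦ hY y hy (neg_eq_of_add_eq_zero_left h0 ▸ hx)
  have hadd : 0 < ‖x + y‖ ^ 2 := pow_pos (norm_pos_iff.2 hxny) 2
  rw [norm_sub_sq_real, hxk, hyk, hm] at hsub
  rw [norm_add_sq_real, hxk, hyk, hm] at hadd
  have hlt : m < k := by exact_mod_cast (by linarith : (m : ℝ) < k)
  have hgt : -(k : ℤ) < m := by exact_mod_cast (by linarith : -(k : ℝ) < m)
  exact ⟨m, hm, by omega⟩

end LatticeShell

theorem proposition4p2_general {n : ℕ} (hn : 2 ≤ n)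
    {L : Submodule ℤ (EuclideanSpace ℝ (Fin n))} (hL : LatticeShell.IsIntegral L) :
    (LatticeShell.ShellEquality L 2 → n = 8) ∧ ¬ LatticeShell.ShellEquality L 3 := by
  refine ⟨fun h ↦ ?_, fun h ↦ ?_⟩
  · obtain ⟨Y, hY⟩ := h.exists_isExtremalHalfShell (by omega) (by omega) hL
    simpa using hY.card_index_eq_eight (by simpa)
  · obtain ⟨Y, hY⟩ := h.exists_isExtremalHalfShell (by omega) (by omega) hL
    exact LatticeShell.not_isExtremalHalfShell_three (by simpa) Y hY

theorem proposition4p2 (n : ℕ) (hn : 2 ≤ n)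
    (L : Submodule ℤ (EuclideanSpace ℝ (Fin n))) [DiscreteTopology L] [IsZLattice ℝ L]
    (hL : LatticeShell.IsIntegral L) :
    (LatticeShell.ShellEquality L 2 → n = 8) ∧ ¬ LatticeShell.ShellEquality L 3 :=
  proposition4p2_general hn hL
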